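/- Let $K/k$ be an algebraic function field, i.e. $K$ is a finitely generated field extension of $k$ of positive transcendence degree. Let $\tilde k$ be the algebraic closure of $k$ in $K$ (the constant field), let $\overline K$ be an algebraic closure of $K$, and let $\bar k$ be the algebraic closure of $k$ in $\overline K$. Let $\ell$ be a prime number different from the characteristic of $k$. For $\alpha\in K^\times\setminus\tilde k^\times$, the $\ell$-divisibility parameter modulo constants of $\alpha$ is the largest integer $D\ge 0$ such that $\alpha\in\tilde k^\times K^{\times \ell^D}$. Elements $\beta_1,\ldots,\beta_r\in K^\times$ are $\ell$-independent modulo constants if $\prod_i\beta_i^{x_i}\notin\tilde k^\times K^{\times\ell}$ for every $(x_1,\ldots,x_r)\in\mathbb Z^r\setminus(\ell\mathbb Z)^r$. For a subgroup $G$ of $K^\times$ and $m\ge 1$, write $\bar kK(\sqrt[m]{G})$ for the subfield of $\overline K$ generated by $\bar k$, $K$ and all $m$-th roots of the elements of $G$. Let $G$ be a finitely generated torsion-free subgroup of $K^\times$, of rank $r$. A basis $\{\alpha_1,\ldots,\alpha_r\}$ of $G$ consisting of elements outside $\tilde k^\times$, with $\ell$-divisibility parameters modulo constants $D_1,\ldots,D_r$,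 may have one of the following properties: (a) $\sum_i D_i$ is maximal among all bases of $G$ that consist of elements outside $\tilde k^\times$; (b) one can write $\alpha_i=c_i\beta_i^{\ell^{D_i}}$ with $c_i\in\tilde k^\times$ and $\beta_i\in K^\times$ such that $\beta_1,\ldots,\beta_r$ are $\ell$-independent modulo constants. Either of (a), (b) may be taken as the definition of an $\ell$-good basis modulo constants; the statements below hold for both. (1) Suppose that $r>0$ and $G\cap\tilde k^\times=\{1\}$. Then: (i) $G$ has an $\ell$-good basis modulo constants; more precisely, it has a basis satisfying both (a) and (b). (ii) For all sufficiently large $n$ we have $$[\bar kK(\sqrt[\ell^{n+1}]{G}):\bar kK(\sqrt[\ell^{n}]{G})]=\ell^r.$$ (iii) There is an integer $\varepsilon\ge 0$ such that $G\cap\tilde k^\times K^{\times\ell^n}\subseteq G^{\ell^{n-\varepsilon}}$ for all $n>\varepsilon$. (2) $G$ has an $\ell$-good basis modulo constants, in the sense of (a), if and only if the rank $r$ of $G$ equals the rank of $G$ modulo constants, i.e. the rank of $G/(G\cap\tilde k^\times)$, the image of $G$ in $K^\times/\tilde k^\times$. The same holds in the sense of (b). (The empty family counts as a good basis of the trivial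 group.) -/

import Mathlib

open Filter

/-- `K / k` is an algebraic function field (in some number `n ≥ 1` of variables): `K` is finitely
generated as a field over `k`, of positive transcendence degree (the transcendence degree is
automatically finite, because `K / k` is finitely generated). -/
structure IsAlgFunctionField (k K : Type*) [Field k] [Field K] [Algebra k K] : Prop where
  fg : (⊤ : IntermediateField k K).FG
  trdeg_pos : 0 < Algebra.trdeg k K

namespace ModConst

/-- The rank of a (finitely generated) commutative group: the maximal number of `ℤ`-linearly
independent elements. -/
noncomputable def groupRank (A : Type*) [CommGroup A] : ℕ :=
  Module.finrank ℤ (Additive A)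

section Group

variable (k K : Type*) [Field k] [Field K] [Algebra k K]

/-- The multiplicative group of the constant field of `K / k` (the algebraic closure of `k`
inside `K`), as a subgroup of `Kˣ`. -/
noncomputable def constUnits : Subgroup Kˣ :=
  (Units.map (algebraMap (algebraicClosure k K) K : algebraicClosure k K →* K)).range

/-- The subgroup of `Kˣ` consisting of the products `c * β ^ m` with `c` a nonzero constant and
`β ∈ Kˣ`. -/
noncomputable def constMulPow (m : ℕ) : Subgroup Kˣ :=
  constUnits k K ⊔ (powMonoidHom m : Kˣ →* Kˣ).range

/-- `D` is the `ℓ`-divisibility parameter modulo constants of `α`: the largest natural number `D`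
such that `α` is a constant times an `ℓ ^ D`-th power. (There is none if `α` is a constant.) -/
def IsDivParam (ℓ : ℕ) (α : Kˣ) (D : ℕ) : Prop :=
  IsGreatest {n : ℕ | α ∈ constMulPow k K (ℓ ^ n)} D

/-- `α` is `ℓ`-indivisible modulo constants. -/
def IsIndivisible (ℓ : ℕ) (α : Kˣ) : Prop :=
  α ∉ constMulPow k K ℓ

/-- The elements `β i` are `ℓ`-independent modulo constants. -/
def IsIndependent (ℓ : ℕ) {r : ℕ} (β : Fin r → Kˣ) : Prop :=
  ∀ x : Fin r → ℤ, ¬ (∀ i, (ℓ : ℤ) ∣ x i) → IsIndivisible k K ℓ (∏ i, β i ^ x i)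

variable {K}

/-- The rank of `G` modulo constants: the rank of the quotient of `G` by its subgroup of constants
(that is, of the image of `G` in the quotient of `Kˣ` by the nonzero constants). -/
noncomputable def groupRankModConst (G : Subgroup Kˣ) : ℕ :=
  groupRank (G ⧸ (constUnits k K).subgroupOf G)

/-- A basis of (the free abelian group) `G` with `r` elements. -/
abbrev GroupBasis (G : Subgroup Kˣ) (r : ℕ) : Type _ :=
  Module.Basis (Fin r) ℤ (Additive G)

/-- The `i`-th element of a basis of `G`, as an element of `Kˣ`. -/
noncomputable def GroupBasis.elem {G : Subgroup Kˣ} {r : ℕ} (b : GroupBasis G r) (i : Fin r) : Kˣ :=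
  ((b i).toMul : G)

/-- `ℓ`-good basis modulo constants, first form: the sum of the `ℓ`-divisibility parameters
modulo constants of the elements of the basis is maximal among the bases of `G`
(all of whose elements have such a parameter). -/
def IsGoodBasisMax (ℓ : ℕ) {G : Subgroup Kˣ} {r : ℕ} (b : GroupBasis G r) : Prop :=
  ∃ D : Fin r → ℕ, (∀ i, IsDivParam k K ℓ (b.elem i) (D i)) ∧
    ∀ (b' : GroupBasis G r) (D' : Fin r → ℕ),
      (∀ i, IsDivParam k K ℓ (b'.elem i) (D' i)) → ∑ i, D' i ≤ ∑ i, D i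

/-- `ℓ`-good basis modulo constants, second form: the elements of the basis are
`c i * β i ^ (ℓ ^ D i)`, where the `D i` are their `ℓ`-divisibility parameters modulo constants,
the `c i` are constants, and the `β i` are `ℓ`-independent modulo constants. -/
def IsGoodBasisIndep (ℓ : ℕ) {G : Subgroup Kˣ} {r : ℕ} (b : GroupBasis G r) : Prop :=
  ∃ (D : Fin r → ℕ) (c β : Fin r → Kˣ),
    (∀ i, IsDivParam k K ℓ (b.elem i) (D i)) ∧
    (∀ i, c i ∈ constUnits k K) ∧
    (∀ i, b.elem i = c i * β i ^ (ℓ ^ D i)) ∧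
    IsIndependent k K ℓ β

/-- The field `k̄ K (ᵐ√G)` inside an algebraic closure `Ω` of `K`: it is generated over `K` by the
algebraic closure `k̄` of `k` in `Ω` and by all the `m`-th roots of the elements of `G`. -/
noncomputable def geomKummer (Ω : Type*) [Field Ω] [Algebra k Ω] [Algebra K Ω]
    (G : Subgroup Kˣ) (m : ℕ) : IntermediateField K Ω :=
  IntermediateField.adjoin K
    ((algebraicClosure k Ω : Set Ω) ∪ {x : Ω | ∃ g ∈ G, x ^ m = algebraMap K Ω (g : K)})

end Group

end ModConst

/-! Let `V` be `Kˣ` modulo nonzero constants, written additively; divisibility modulo constants is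
divisibility in `V`. The one fact needed from function fields is that homomorphisms to `ℤ` separate
the points of `V`: for `α` transcendental, complete `α` to a transcendence basis, let `L` be
generated by the other members, and take the degree of the norm from `K` to `L(α)`.

For a finitely generated `Γ ≤ V`, separation embeds the `ℓ`-saturation `S` of `Γ` in some `ℤ^m`, so
`S` is finitely generated and `ℓ^ε S ⊆ Γ`. This gives (iii). The Smith normal form of `Γ` in `S` has
`ℓ`-power entries up to units, which gives a basis as in (b); comparing determinants shows that it
also satisfies (a).

For (2), equality of ranks means that `G → V` is injective, and then (1)(i) applies (its argument
also covers `r = 0`). Conversely, (b) makes the images of the basis linearly independent. If (a)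
held with a nontrivial kernel, some basis element would be nonconstant, and adding to a constant
basis element a highly `ℓ`-divisible multiple of a nonconstant one would make the sum of parameters
unbounded.

For (ii), work over `F = k̄K`, which contains the roots of unity and whose constants are all
`ℓ^n`-th powers. Kummer theory gives degree `[G : G ∩ F^{×ℓ^n}]`, and (iii) over `F` gives `G ∩
F^{×ℓ^(n+1)} = (G ∩ F^{×ℓ^n})^ℓ` for large `n`, so the index is multiplied by `[G : G^ℓ] = ℓ^r`. -/

/-! ### Integer-valued homomorphisms that kill the constants -/

/-- The degree of rational functions, as a homomorphism on units. -/
noncomputable def RatFunc.intDegreeHom (L : Type*) [Field L] :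
    (RatFunc L)ˣ →* Multiplicative ℤ where
  toFun u := Multiplicative.ofAdd (u : RatFunc L).intDegree
  map_one' := by simp
  map_mul' u v := by
    rw [← ofAdd_add, Units.val_mul, RatFunc.intDegree_mul u.ne_zero v.ne_zero]

theorem RatFunc.intDegree_eq_zero_of_isAlgebraic {L : Type*} [Field L] {f : RatFunc L}
    (hf : IsAlgebraic L f) : f.intDegree = 0 := by
  by_cases h : ∃ c, f = RatFunc.C c
  · obtain ⟨c, rfl⟩ := h
    exact RatFunc.intDegree_C c
  · exact absurd hf (RatFunc.transcendental_of_ne_C _ h)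

theorem exists_transcendental_intermediateField {k K : Type*} [Field k] [Field K] [Algebra k K]
    {α : K} (hα : Transcendental k α) :
    ∃ L : IntermediateField k K, Transcendental L α ∧
      Algebra.IsAlgebraic (IntermediateField.adjoin L {α}) K := by
  obtain ⟨t, hαt, ht⟩ := exists_isTranscendenceBasis_superset (R := k) (s := ({α} : Set K))
    ((algebraicIndependent_singleton_iff (x := fun y : ({α} : Set K) => id (y : K))
      ⟨α, rfl⟩).2 hα)
  refine ⟨IntermediateField.adjoin k (t \ {α}), ?_, ?_⟩
  · have h := ht.1.transcendental_adjoin (s := {x | (x : K) ≠ α}) (i := ⟨α, hαt rfl⟩) (by simp)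
    have himg : ((↑) : t → K) '' {x | (x : K) ≠ α} = t \ {α} := by
      ext x; simp [and_comm]
    rw [himg] at h
    intro halg
    open scoped IntermediateField.algebraAdjoinAdjoin in
    exact h ((IsFractionRing.isAlgebraic_iff (Algebra.adjoin k (t \ {α}))
      (IntermediateField.adjoin k (t \ {α})) K).2 halg)
  · have h := ht.isAlgebraic_field
    rw [Subtype.range_coe] at h
    set L := IntermediateField.adjoin k (t \ {α})
    have hle : IntermediateField.adjoin k t ≤
        (IntermediateField.adjoin L {α}).restrictScalars k := by
      rw [IntermediateField.adjoin_le_iff]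
      intro x hx
      by_cases hxα : x = α
      · subst hxα
        exact IntermediateField.mem_adjoin_simple_self L x
      · exact (IntermediateField.adjoin L {α}).algebraMap_mem
          (⟨x, IntermediateField.subset_adjoin k _ ⟨hx, hxα⟩⟩ : L)
    refine ⟨fun x => ?_⟩
    obtain ⟨p, hp, hpx⟩ := h.isAlgebraic x
    let ι : IntermediateField.adjoin k t →+* IntermediateField.adjoin L {α} :=
      (IntermediateField.inclusion hle).toRingHom
    refine ⟨p.map ι, (Polynomial.map_ne_zero_iff ι.injective).2 hp, ?_⟩
    rw [Polynomial.aeval_def] at hpx ⊢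
    rw [Polynomial.eval₂_map]
    exact hpx

/-- The homomorphism is the degree of the norm to `F = L(α) ≅ L(X)`. The norm of a constant is
algebraic over `L`, hence of degree `0`; the norm of `α` is `α ^ [K : F]`, of degree `[K : F] ≠ 0`.
-/
theorem exists_hom_int_of_transcendental {k K : Type*} [Field k] [Field K] [Algebra k K]
    (hfg : (⊤ : IntermediateField k K).FG) {α : Kˣ} (hα : Transcendental k (α : K)) :
    ∃ v : Kˣ →* Multiplicative ℤ, (∀ c : Kˣ, IsAlgebraic k (c : K) → v c = 1) ∧ v α ≠ 1 := by
  obtain ⟨L, hL, halg⟩ := exists_transcendental_intermediateField hα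
  set F := IntermediateField.adjoin L {(α : K)} with hF
  have hfin : FiniteDimensional F K := by
    obtain ⟨S, hS⟩ := hfg
    have htop : IntermediateField.adjoin F (S : Set K) = ⊤ := by
      rw [eq_top_iff]
      intro x _
      have hx : x ∈ IntermediateField.adjoin k (S : Set K) := hS ▸ IntermediateField.mem_top
      have hle : IntermediateField.adjoin k (S : Set K) ≤
          ((IntermediateField.adjoin F (S : Set K)).restrictScalars L).restrictScalars k := by
        rw [IntermediateField.adjoin_le_iff]
        exact IntermediateField.subset_adjoin F _
      exact hle hx
    have := IntermediateField.finiteDimensional_adjoin (K := F) (S := (S : Set K))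
      fun x _ => (halg.isAlgebraic x).isIntegral
    rw [htop] at this
    exact Module.Finite.equiv (IntermediateField.topEquiv (F := F) (E := K)).toLinearEquiv
  let e := RatFunc.algEquivOfTranscendental (α : K) hL
  let v : Kˣ →* Multiplicative ℤ := (RatFunc.intDegreeHom L).comp
    ((Units.map (e.symm : F →* RatFunc L)).comp (Units.map (Algebra.norm F : K →* F)))
  have hv : ∀ x : Kˣ, v x = Multiplicative.ofAdd (e.symm (Algebra.norm F (x : K))).intDegree :=
    fun x => rfl
  refine ⟨v, fun c hc => ?_, ?_⟩
  · rw [hv, RatFunc.intDegree_eq_zero_of_isAlgebraic, ofAdd_zero]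
    have h1 : IsIntegral L (Algebra.norm F (c : K)) :=
      Algebra.isIntegral_norm F (hc.isIntegral.tower_top)
    exact (h1.map (e.symm : F →ₐ[L] RatFunc L)).isAlgebraic
  · have h1 : Algebra.norm F (α : K) =
        IntermediateField.AdjoinSimple.gen L (α : K) ^ Module.finrank F K :=
      Algebra.norm_algebraMap (S := K) (IntermediateField.AdjoinSimple.gen L (α : K))
    rw [hv, h1, map_pow, RatFunc.algEquivOfTranscendental_symm_gen]
    have hdeg : ∀ n : ℕ, ((RatFunc.X : RatFunc L) ^ n).intDegree = n := by
      intro n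
      induction n with
      | zero => simp
      | succ n ih =>
        rw [pow_succ, RatFunc.intDegree_mul (pow_ne_zero _ RatFunc.X_ne_zero) RatFunc.X_ne_zero, ih]
        simp
    rw [hdeg, Ne, ofAdd_eq_one, Nat.cast_eq_zero]
    exact Module.finrank_pos.ne'

/-! ### Saturation and good bases in abelian groups separated by maps to `ℤ` -/

section Saturation

variable {V : Type*} [AddCommGroup V]

/-- An abelian group is separated by its homomorphisms to `ℤ`. -/
def IsIntSeparated (V : Type*) [AddCommGroup V] : Prop :=
  ∀ v : V, v ≠ 0 → ∃ f : V →ₗ[ℤ] ℤ, f v ≠ 0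

theorem IsIntSeparated.isTorsionFree (hV : IsIntSeparated V) : Module.IsTorsionFree ℤ V := by
  refine Module.IsTorsionFree.of_smul_eq_zero fun n v h => ?_
  by_contra! hc
  obtain ⟨f, hf⟩ := hV v hc.2
  have := congrArg f h
  simp only [map_smul, smul_eq_mul, map_zero, mul_eq_zero] at this
  exact this.elim hc.1 hf

/-- The elements of an abelian group of which some `p`-power multiple lies in a given subgroup. -/
def Submodule.primeSaturation (Γ : Submodule ℤ V) (p : ℕ) : Submodule ℤ V where
  carrier := {v | ∃ n : ℕ, p ^ n • v ∈ Γ}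
  zero_mem' := ⟨0, by simp⟩
  add_mem' := by
    rintro v w ⟨m, hm⟩ ⟨n, hn⟩
    refine ⟨m + n, ?_⟩
    rw [smul_add]
    refine Γ.add_mem ?_ ?_
    · rw [pow_add, mul_comm, mul_smul]
      exact Γ.smul_of_tower_mem _ hm
    · rw [pow_add, mul_smul]
      exact Γ.smul_of_tower_mem _ hn
  smul_mem' := by
    rintro c v ⟨n, hn⟩
    exact ⟨n, by rw [smul_comm]; exact Γ.smul_mem c hn⟩

theorem Submodule.le_primeSaturation (Γ : Submodule ℤ V) (p : ℕ) : Γ ≤ Γ.primeSaturation p :=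
  fun v hv => ⟨0, by simpa using hv⟩

/-- The restrictions to `Γ` of functionals on `V` form a subgroup of the finitely generated dual of
`Γ`, so finitely many functionals already separate `Γ`. -/
theorem IsIntSeparated.exists_injOn (hV : IsIntSeparated V) (Γ : Submodule ℤ V)
    [Module.Finite ℤ Γ] :
    ∃ (m : ℕ) (φ : V →ₗ[ℤ] (Fin m → ℤ)), ∀ v ∈ Γ, φ v = 0 → v = 0 := by
  have := hV.isTorsionFree
  let R : (V →ₗ[ℤ] ℤ) →ₗ[ℤ] (Γ →ₗ[ℤ] ℤ) := LinearMap.lcomp ℤ ℤ Γ.subtype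
  have hfree : Module.Free ℤ Γ := inferInstance
  have hfin : Module.Finite ℤ (LinearMap.range R) := inferInstance
  obtain ⟨m, s, hs⟩ := Module.Finite.exists_fin (R := ℤ) (M := LinearMap.range R)
  choose f hf using fun j => (s j).2
  refine ⟨m, LinearMap.pi f, fun v hv hφ => ?_⟩
  by_contra hne
  obtain ⟨g, hg⟩ := hV v hne
  apply hg
  have hspan : ∀ w : LinearMap.range R, (w : Γ →ₗ[ℤ] ℤ) ⟨v, hv⟩ = 0 := by
    intro w
    have hw : w ∈ Submodule.span ℤ (Set.range s) := hs ▸ Submodule.mem_top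
    induction hw using Submodule.span_induction with
    | mem x hx =>
      obtain ⟨j, rfl⟩ := hx
      rw [← hf j]
      exact congrFun hφ j
    | zero => rfl
    | add x y _ _ hx hy => simp [hx, hy]
    | smul a x _ hx => simp [hx]
  exact hspan ⟨R g, g, rfl⟩

/-- A map to `ℤ^m` injective on `Γ` stays injective on the saturation: if it kills `v`, it kills `p
^ n • v ∈ Γ`, and `V` is torsion-free. -/
theorem IsIntSeparated.finite_primeSaturation (hV : IsIntSeparated V) (Γ : Submodule ℤ V)
    [Module.Finite ℤ Γ] {p : ℕ} (hp : p ≠ 0) : Module.Finite ℤ (Γ.primeSaturation p) := by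
  have := hV.isTorsionFree
  obtain ⟨m, φ, hφ⟩ := hV.exists_injOn Γ
  refine Module.Finite.of_injective (φ.comp (Γ.primeSaturation p).subtype) ?_
  rw [← LinearMap.ker_eq_bot, LinearMap.ker_eq_bot']
  rintro ⟨v, n, hn⟩ hv
  have hv' : φ v = 0 := hv
  have h1 := hφ _ hn (by rw [map_nsmul, hv', smul_zero])
  rw [← natCast_zsmul, smul_eq_zero] at h1
  have hpn : ((p ^ n : ℕ) : ℤ) ≠ 0 := by exact_mod_cast pow_ne_zero n hp
  exact Subtype.ext (h1.resolve_left hpn)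

theorem IsIntSeparated.exists_uniform_pow (hV : IsIntSeparated V) (Γ : Submodule ℤ V)
    [Module.Finite ℤ Γ] {p : ℕ} (hp : p ≠ 0) :
    ∃ ε : ℕ, ∀ v ∈ Γ.primeSaturation p, p ^ ε • v ∈ Γ := by
  have := hV.finite_primeSaturation Γ hp
  obtain ⟨m, s, hs⟩ := Module.Finite.exists_fin (R := ℤ) (M := Γ.primeSaturation p)
  choose n hn using fun j => (s j).2
  refine ⟨Finset.univ.sup n, fun v hv => ?_⟩
  have hspan : ∀ w : Γ.primeSaturation p, p ^ (Finset.univ.sup n) • (w : V) ∈ Γ := by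
    intro w
    have hw : w ∈ Submodule.span ℤ (Set.range s) := hs ▸ Submodule.mem_top
    induction hw using Submodule.span_induction with
    | mem x hx =>
      obtain ⟨j, rfl⟩ := hx
      have hle : n j ≤ Finset.univ.sup n := Finset.le_sup (Finset.mem_univ j)
      rw [← Nat.sub_add_cancel hle, pow_add, mul_smul]
      exact Γ.smul_of_tower_mem _ (hn j)
    | zero => simp
    | add x y _ _ hx hy =>
      rw [Submodule.coe_add, smul_add]
      exact Γ.add_mem hx hy
    | smul a x _ hx =>
      rw [Submodule.coe_smul, smul_comm]
      exact Γ.smul_mem a hx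
  exact hspan ⟨v, hv⟩

/-- A family in an abelian group is independent modulo `p`-multiples. -/
def IsIndepMod (p : ℕ) {ι : Type*} [Fintype ι] (β : ι → V) : Prop :=
  ∀ (x : ι → ℤ) (w : V), ∑ i, x i • β i = p • w → ∀ i, (p : ℤ) ∣ x i

theorem IsIndepMod.exists_of_pow_smul [Module.IsTorsionFree ℤ V] {p : ℕ} (hp : p ≠ 0) {ι : Type*}
    [Fintype ι] {β : ι → V} (hβ : IsIndepMod p β) (n : ℕ) (x : ι → ℤ) (w : V)
    (h : ∑ i, x i • β i = p ^ n • w) :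
    ∃ y : ι → ℤ, (∀ i, x i = (p : ℤ) ^ n * y i) ∧ ∑ i, y i • β i = w := by
  induction n generalizing x w with
  | zero => exact ⟨x, by simp, by simpa using h⟩
  | succ n ih =>
    obtain ⟨y, hy, hyw⟩ := ih x (p • w) (by rw [h, pow_succ, mul_smul])
    choose z hz using hβ y w hyw
    refine ⟨z, fun i => by rw [hy, hz]; ring, ?_⟩
    have hp' : (p : ℤ) ≠ 0 := by exact_mod_cast hp
    apply smul_right_injective V hp'
    simp only [Finset.smul_sum, smul_smul, ← hz, hyw, natCast_zsmul]

theorem IsIndepMod.linearIndependent [Module.IsTorsionFree ℤ V] {p : ℕ} (hp : 1 < p) {ι : Type*}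
    [Fintype ι] {β : ι → V} (hβ : IsIndepMod p β) : LinearIndependent ℤ β := by
  rw [Fintype.linearIndependent_iff]
  intro x hx i
  -- A relation has coefficients divisible by every power of `p`; the exponent `|x i|` suffices
  -- since `p ^ |x i| > |x i|`.
  obtain ⟨y, hy, -⟩ := hβ.exists_of_pow_smul (by omega) (x i).natAbs x 0 (by simpa using hx)
  refine Int.eq_zero_of_abs_lt_dvd ⟨y i, hy i⟩ ?_
  rw [← Int.natCast_natAbs]
  exact_mod_cast Nat.lt_pow_self hp

/-- Take bases of `Γ` and of its saturation `S` in Smith normal form. The entries divide `p ^ ε`,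
and a basis of `S` is independent modulo `p` in `V` because `S` is `p`-saturated. -/
theorem IsIntSeparated.exists_basis (hV : IsIntSeparated V) (Γ : Submodule ℤ V)
    [Module.Finite ℤ Γ] {p : ℕ} (hp : p.Prime) {r : ℕ} (hr : Module.finrank ℤ Γ = r) :
    ∃ (b : Module.Basis (Fin r) ℤ Γ) (D : Fin r → ℕ) (β : Fin r → V),
      (∀ i, (b i : V) = p ^ D i • β i) ∧ IsIndepMod p β := by
  have := hV.isTorsionFree
  have := hV.finite_primeSaturation Γ hp.ne_zero
  obtain ⟨ε, hε⟩ := hV.exists_uniform_pow Γ hp.ne_zero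
  set S := Γ.primeSaturation p with hS
  have hΓS : Γ ≤ S := Γ.le_primeSaturation p
  let N : Submodule ℤ S := Γ.submoduleOf S
  let e : N ≃ₗ[ℤ] Γ := Submodule.submoduleOfEquivOfLe hΓS
  have hpε : ((p ^ ε : ℕ) : ℤ) ≠ 0 := by exact_mod_cast pow_ne_zero ε hp.ne_zero
  -- Multiplication by `p ^ ε` injects `S` into `N`, so the Smith form has full rank.
  have hrank : Module.finrank ℤ N = Module.finrank ℤ S := by
    refine le_antisymm (Submodule.finrank_le N) ?_
    let f : S →ₗ[ℤ] N := LinearMap.codRestrict N (((p ^ ε : ℕ) : ℤ) • LinearMap.id) (by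
      intro x
      change (((p ^ ε : ℕ) : ℤ) • (x : V)) ∈ Γ
      rw [natCast_zsmul]
      exact hε x x.2)
    refine LinearMap.finrank_le_finrank_of_injective (f := f) ?_
    intro x y hxy
    have := congrArg (Subtype.val) hxy
    exact smul_right_injective S hpε this
  have hrS : Module.finrank ℤ S = r := by rw [← hrank, e.finrank_eq, hr]
  obtain ⟨b, a, ab, hab⟩ := Submodule.exists_smith_normal_form_of_rank_eq
    (Module.finBasisOfFinrankEq ℤ S hrS) hrank
  have hdvd : ∀ i, a i ∣ (p : ℤ) ^ ε := by
    intro i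
    have hmem : ((p ^ ε : ℕ) : ℤ) • b i ∈ N := by
      change (((p ^ ε : ℕ) : ℤ) • (b i : V)) ∈ Γ
      rw [natCast_zsmul]
      exact hε _ (b i).2
    have h1 := congrArg (fun z : N => b.repr (z : S) i) (ab.sum_repr ⟨_, hmem⟩)
    simp only [Submodule.coe_sum, Submodule.coe_smul, hab, map_sum, map_smul, Finsupp.coe_finsetSum,
      Finset.sum_apply, Finsupp.smul_apply, Module.Basis.repr_self, smul_eq_mul,
      Finsupp.single_apply, mul_ite, mul_one, mul_zero, Finset.sum_ite_eq',
      Finset.mem_univ, if_true] at h1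
    push_cast at h1
    rw [← h1]
    exact Dvd.intro_left _ rfl
  have hD : ∀ i, ∃ (n : ℕ) (u : ℤ), IsUnit u ∧ a i = (p : ℤ) ^ n * u := by
    intro i
    obtain ⟨n, -, hn⟩ := (dvd_prime_pow (Nat.prime_iff_prime_int.1 hp) ε).1 (hdvd i)
    obtain ⟨u, hu⟩ := hn.symm
    exact ⟨n, u, u.isUnit, hu.symm⟩
  choose D u hu hau using hD
  -- The entry is `a i = p ^ D i * u i`; its unit part is absorbed into `β i`.
  refine ⟨ab.map e, D, fun i => u i • (b i : V), fun i => ?_, fun x w hw i => ?_⟩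
  · have h1 : ((ab.map e) i : V) = ((ab i : S) : V) := rfl
    rw [h1, hab, hau, Submodule.coe_smul, mul_smul, ← natCast_zsmul, Nat.cast_pow]
  · have hwS : w ∈ S := by
      have h1 : p • w ∈ S := by
        rw [← hw]
        exact S.sum_mem fun j _ => S.smul_mem _ (S.smul_mem _ (b j).2)
      obtain ⟨n, hn⟩ := h1
      exact ⟨n + 1, by rwa [pow_succ, mul_smul]⟩
    have h1 : ∑ j, (x j * u j) • b j = (p : ℤ) • (⟨w, hwS⟩ : S) := by
      apply Subtype.ext
      simp only [Submodule.coe_sum, Submodule.coe_smul, mul_smul, natCast_zsmul, hw]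
      rfl
    have h2 := congrArg (fun z => b.repr z i) h1
    rw [b.repr_sum_self, map_smul, Finsupp.smul_apply, smul_eq_mul] at h2
    exact (hu i).dvd_mul_right.1 (Dvd.intro _ h2.symm)

/-- With `T` the unimodular change of basis, independence of `β` gives an integral `M` with `diag(p
^ D) T = M diag(p ^ D')`. Determinants then show that `p ^ ∑ D'` divides `p ^ ∑ D`. -/
theorem sum_le_sum_of_isIndepMod [Module.IsTorsionFree ℤ V] {Γ : Submodule ℤ V} {p : ℕ}
    (hp : 1 < p) {r : ℕ} (b b' : Module.Basis (Fin r) ℤ Γ) {D D' : Fin r → ℕ} {β γ : Fin r → V}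
    (hb : ∀ i, (b i : V) = p ^ D i • β i) (hβ : IsIndepMod p β)
    (hb' : ∀ i, (b' i : V) = p ^ D' i • γ i) : ∑ i, D' i ≤ ∑ i, D i := by
  have hli := hβ.linearIndependent hp
  let T := b.toMatrix b'
  have hT : ∀ j, ∑ i, (T i j * (p : ℤ) ^ D i) • β i = p ^ D' j • γ j := by
    intro j
    rw [← hb', ← b.sum_toMatrix_smul_self b' j]
    simp only [Submodule.coe_sum, Submodule.coe_smul, hb, mul_smul, T]
    refine Finset.sum_congr rfl fun i _ => ?_
    rw [← natCast_zsmul, Nat.cast_pow]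
  choose M hM _ using fun j => hβ.exists_of_pow_smul (by omega) (D' j) _ (γ j) (hT j)
  have hmat : Matrix.diagonal (fun i => (p : ℤ) ^ D i) * T =
      (Matrix.of fun i j => M j i) * Matrix.diagonal (fun i => (p : ℤ) ^ D' i) := by
    ext i j
    rw [Matrix.diagonal_mul, Matrix.mul_diagonal, Matrix.of_apply, mul_comm, hM, mul_comm]
  have hdet := congrArg Matrix.det hmat
  rw [Matrix.det_mul, Matrix.det_mul, Matrix.det_diagonal, Matrix.det_diagonal,
    Finset.prod_pow_eq_pow_sum, Finset.prod_pow_eq_pow_sum] at hdet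
  have hunit : IsUnit T.det := by
    have h1 : T * b'.toMatrix b = 1 := b.toMatrix_mul_toMatrix_flip b'
    exact IsUnit.of_mul_eq_one (b'.toMatrix b).det (by rw [← Matrix.det_mul, h1, Matrix.det_one])
  have hdvd : (p : ℤ) ^ (∑ i, D' i) ∣ (p : ℤ) ^ (∑ i, D i) :=
    hunit.dvd_mul_right.1 (Dvd.intro_left _ hdet.symm)
  exact (Nat.pow_dvd_pow_iff_le_right hp).1 (by exact_mod_cast hdvd)

theorem IsIndepMod.isGreatest [Module.IsTorsionFree ℤ V] {p : ℕ} (hp : 1 < p) {ι : Type*}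
    [Fintype ι] {β : ι → V} (hβ : IsIndepMod p β) (i : ι) (D : ℕ) :
    IsGreatest {n : ℕ | ∃ w, p ^ D • β i = p ^ n • w} D := by
  classical
  refine ⟨⟨β i, rfl⟩, fun n hn => ?_⟩
  obtain ⟨w, hw⟩ := hn
  obtain ⟨y, hy, -⟩ := hβ.exists_of_pow_smul (by omega) n (Pi.single i ((p : ℤ) ^ D)) w (by
    rw [← hw, Finset.sum_eq_single i]
    · rw [Pi.single_eq_same, ← natCast_zsmul, Nat.cast_pow]
    · intro j _ hj
      rw [Pi.single_eq_of_ne hj, zero_smul]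
    · simp)
  have h1 := hy i
  rw [Pi.single_eq_same] at h1
  have hdvd : (p : ℤ) ^ n ∣ (p : ℤ) ^ D := ⟨_, h1⟩
  exact (Nat.pow_dvd_pow_iff_le_right hp).1 (by exact_mod_cast hdvd)

theorem IsIntSeparated.exists_isGreatest (hV : IsIntSeparated V) {p : ℕ} (hp : 1 < p) {v : V}
    (hv : v ≠ 0) : ∃ D, IsGreatest {n : ℕ | ∃ w, v = p ^ n • w} D := by
  obtain ⟨f, hf⟩ := hV v hv
  refine BddAbove.exists_isGreatest_of_nonempty ⟨(f v).natAbs, fun n hn => ?_⟩ ⟨0, v, by simp⟩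
  obtain ⟨w, hw⟩ := hn
  have hdvd : ((p ^ n : ℕ) : ℤ) ∣ f v := by
    rw [hw, map_nsmul, nsmul_eq_mul]
    exact Dvd.intro _ rfl
  exact (Nat.lt_pow_self hp).le.trans
    (Nat.le_of_dvd (Int.natAbs_pos.2 hf) (Int.natCast_dvd.1 hdvd))

/-- This makes the sum of parameters unbounded when the kernel is nontrivial. Join a basis of the
kernel to a lift of a basis of the quotient, then add `B • h` to each kernel vector, where `h` is
one of the lifted vectors. -/
theorem exists_basis_map_eq_smul [Module.IsTorsionFree ℤ V] {M : Type*} [AddCommGroup M]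
    [Module.Finite ℤ M] [Module.IsTorsionFree ℤ M] (π : M →ₗ[ℤ] V) (hker : LinearMap.ker π ≠ ⊥)
    (hπ : π ≠ 0) {r : ℕ} (hr : Module.finrank ℤ M = r) {B : ℕ} (hB : B ≠ 0) :
    ∃ (b : Module.Basis (Fin r) ℤ M) (i : Fin r), (∀ j, π (b j) ≠ 0) ∧ ∃ w, π (b i) = B • w := by
  have hBZ : (B : ℤ) ≠ 0 := by exact_mod_cast hB
  let e := π.quotKerEquivRange
  have hQ : Module.IsTorsionFree ℤ (M ⧸ LinearMap.ker π) :=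
    e.injective.moduleIsTorsionFree e (map_smul e)
  have hfree : Module.Free ℤ (M ⧸ LinearMap.ker π) := inferInstance
  let c := Module.finBasis ℤ (LinearMap.ker π)
  let q := Module.finBasis ℤ (M ⧸ LinearMap.ker π)
  let b₀ := c.sumQuot q
  have hinr : ∀ j, π (b₀ (Sum.inr j)) ≠ 0 := by
    intro j h0
    apply q.ne_zero j
    rw [← c.sumQuot_inr q j, Submodule.Quotient.mk_eq_zero]
    exact h0
  have hinl : ∀ j, π (b₀ (Sum.inl j)) = 0 := by
    intro j
    rw [c.sumQuot_inl q j]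
    exact (c j).2
  have hm : 0 < Module.finrank ℤ (LinearMap.ker π) := by
    have : Nontrivial (LinearMap.ker π) := Submodule.nontrivial_iff_ne_bot.2 hker
    exact Module.finrank_pos
  have hn : 0 < Module.finrank ℤ (M ⧸ LinearMap.ker π) := by
    have : Nontrivial (M ⧸ LinearMap.ker π) :=
      Submodule.Quotient.nontrivial_iff.2 fun h => hπ (LinearMap.ker_eq_top.1 h)
    exact Module.finrank_pos
  let h := b₀ (Sum.inr ⟨0, hn⟩)
  -- The transvection `x ↦ x + lam x • (B • h)` moves exactly the kernel part of the basis.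
  let lam : Module.Dual ℤ M := b₀.constr ℤ (Sum.elim (fun _ => 1) (fun _ => 0))
  have hlamr : ∀ j, lam (b₀ (Sum.inr j)) = 0 := fun j => by
    simp only [lam, Module.Basis.constr_basis, Sum.elim_inr]
  have hlaml : ∀ j, lam (b₀ (Sum.inl j)) = 1 := fun j => by
    simp only [lam, Module.Basis.constr_basis, Sum.elim_inl]
  have hlam : lam ((B : ℤ) • h) = 0 := by rw [map_smul, hlamr, smul_zero]
  let b₁ := b₀.map (LinearEquiv.transvection hlam)
  have hl : ∀ j, π (b₁ (Sum.inl j)) = (B : ℤ) • π h := by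
    intro j
    rw [Module.Basis.map_apply, LinearEquiv.transvection.apply, map_add, hinl, zero_add, hlaml,
      one_smul, map_smul]
  have hr' : ∀ j, π (b₁ (Sum.inr j)) = π (b₀ (Sum.inr j)) := by
    intro j
    rw [Module.Basis.map_apply, LinearEquiv.transvection.apply, hlamr, zero_smul, add_zero]
  let σ := Fintype.equivFinOfCardEq ((Module.finrank_eq_card_basis b₁).symm.trans hr)
  refine ⟨b₁.reindex σ, σ (Sum.inl ⟨0, hm⟩), fun j => ?_, π h, ?_⟩
  · rw [Module.Basis.reindex_apply]
    rcases σ.symm j with i | i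
    · rw [hl]
      exact smul_ne_zero hBZ (hinr _)
    · rw [hr']
      exact hinr i
  · rw [Module.Basis.reindex_apply, Equiv.symm_apply_apply, hl, natCast_zsmul]

end Saturation

/-! ### Units modulo constants, good bases and ranks -/

namespace ModConst

section Classes

variable (k : Type*) {K : Type*} [Field k] [Field K] [Algebra k K]

theorem mem_constUnits_iff {a : Kˣ} : a ∈ constUnits k K ↔ IsAlgebraic k (a : K) := by
  constructor
  · rintro ⟨c, rfl⟩
    exact mem_algebraicClosure_iff.1 (c : algebraicClosure k K).2
  · intro ha
    have hne : (⟨a, mem_algebraicClosure_iff.2 ha⟩ : algebraicClosure k K) ≠ 0 := fun h =>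
      a.ne_zero (congrArg Subtype.val h)
    exact ⟨Units.mk0 _ hne, Units.ext rfl⟩

variable (K) in
/-- The group of units modulo constants, in additive notation. -/
def UnitClasses : Type _ := Additive (Kˣ ⧸ constUnits k K)

noncomputable instance : AddCommGroup (UnitClasses k K) :=
  inferInstanceAs (AddCommGroup (Additive (Kˣ ⧸ constUnits k K)))

/-- The class of a unit modulo constants. -/
noncomputable def classMod (a : Kˣ) : UnitClasses k K := Additive.ofMul (QuotientGroup.mk a)

theorem classMod_surjective : Function.Surjective (classMod k (K := K)) := fun v =>
  QuotientGroup.mk_surjective v.toMul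

theorem classMod_eq_iff {a b : Kˣ} : classMod k a = classMod k b ↔ a / b ∈ constUnits k K := by
  rw [← QuotientGroup.eq_iff_div_mem]
  rfl

theorem classMod_eq_zero_iff {a : Kˣ} : classMod k a = 0 ↔ a ∈ constUnits k K :=
  QuotientGroup.eq_one_iff a

theorem classMod_pow (a : Kˣ) (n : ℕ) : classMod k (a ^ n) = n • classMod k a := rfl

theorem classMod_prod_zpow {ι : Type*} [Fintype ι] (β : ι → Kˣ) (x : ι → ℤ) :
    classMod k (∏ i, β i ^ x i) = ∑ i, x i • classMod k (β i) :=
  map_prod (QuotientGroup.mk' (constUnits k K)) _ _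

theorem mem_constMulPow_iff {a : Kˣ} {m : ℕ} :
    a ∈ constMulPow k K m ↔ ∃ w, classMod k a = m • w := by
  rw [constMulPow, Subgroup.mem_sup]
  constructor
  · rintro ⟨c, hc, _, ⟨β, rfl⟩, rfl⟩
    refine ⟨classMod k β, ?_⟩
    rw [← classMod_pow, classMod_eq_iff]
    simpa using hc
  · rintro ⟨w, hw⟩
    obtain ⟨β, rfl⟩ := classMod_surjective k w
    rw [← classMod_pow, classMod_eq_iff] at hw
    exact ⟨_, hw, _, ⟨β, rfl⟩, div_mul_cancel _ _⟩

theorem isDivParam_iff {ℓ : ℕ} {a : Kˣ} {D : ℕ} :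
    IsDivParam k K ℓ a D ↔ IsGreatest {n : ℕ | ∃ w, classMod k a = ℓ ^ n • w} D := by
  simp only [IsDivParam, mem_constMulPow_iff]

theorem isIndependent_iff {ℓ r : ℕ} {β : Fin r → Kˣ} :
    IsIndependent k K ℓ β ↔ IsIndepMod ℓ fun i => classMod k (β i) := by
  simp only [IsIndependent, IsIndivisible, IsIndepMod, mem_constMulPow_iff, classMod_prod_zpow]
  refine forall_congr' fun x => ?_
  rw [not_imp_not]
  exact forall_exists_index

theorem isIntSeparated (hfg : (⊤ : IntermediateField k K).FG) :
    IsIntSeparated (UnitClasses k K) := by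
  intro v hv
  obtain ⟨a, rfl⟩ := classMod_surjective k v
  rw [Ne, classMod_eq_zero_iff, mem_constUnits_iff] at hv
  obtain ⟨f, hf, hfa⟩ := exists_hom_int_of_transcendental hfg hv
  let g : Kˣ ⧸ constUnits k K →* Multiplicative ℤ :=
    QuotientGroup.lift _ f fun c hc => hf c ((mem_constUnits_iff k).1 hc)
  let h : UnitClasses k K →+ ℤ :=
    { toFun := fun v => (g (Additive.toMul v)).toAdd
      map_zero' := congrArg Multiplicative.toAdd g.map_one
      map_add' := fun v w => congrArg Multiplicative.toAdd (g.map_mul v.toMul w.toMul) }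
  exact ⟨h.toIntLinearMap, fun h0 => hfa h0⟩

variable (G : Subgroup Kˣ)

/-- The homomorphism from a group of units to the classes modulo constants. -/
noncomputable def classHom : Additive G →ₗ[ℤ] UnitClasses k K :=
  AddMonoidHom.toIntLinearMap
    { toFun := fun g => classMod k (g.toMul : Kˣ)
      map_zero' := rfl
      map_add' := fun _ _ => rfl }

variable {G}

theorem classHom_basis {r : ℕ} (b : GroupBasis G r) (i : Fin r) :
    classHom k G (b i) = classMod k (b.elem i) := rfl

theorem ker_classHom_eq_bot_iff :
    LinearMap.ker (classHom k G) = ⊥ ↔ G ⊓ constUnits k K = ⊥ := by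
  rw [LinearMap.ker_eq_bot', Subgroup.eq_bot_iff_forall]
  constructor
  · rintro h x ⟨hx, hc⟩
    have := h (Additive.ofMul ⟨x, hx⟩) ((classMod_eq_zero_iff k).2 hc)
    exact congrArg (fun y : Additive G => (y.toMul : Kˣ)) this
  · intro h g hg
    have := h (g.toMul : Kˣ) ⟨g.toMul.2, (classMod_eq_zero_iff k).1 hg⟩
    exact Subtype.ext this

theorem _root_.Subgroup.FG.finite_additive {A : Type*} [CommGroup A] {G : Subgroup A}
    (hG : G.FG) : Module.Finite ℤ (Additive G) := by
  rw [Module.Finite.iff_addGroup_fg, ← GroupFG.iff_add_fg]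
  exact (Group.fg_iff_subgroup_fg G).2 hG

theorem exists_goodBasis (hfg : (⊤ : IntermediateField k K).FG) {ℓ : ℕ} (hℓ : ℓ.Prime)
    (hG : G.FG) {r : ℕ} (hr : groupRank G = r) (hGC : G ⊓ constUnits k K = ⊥) :
    ∃ b : GroupBasis G r, IsGoodBasisMax k ℓ b ∧ IsGoodBasisIndep k ℓ b := by
  have hsep := isIntSeparated k hfg
  have := hsep.isTorsionFree
  have := hG.finite_additive
  have hinj : Function.Injective (classHom k G) :=
    LinearMap.ker_eq_bot.1 ((ker_classHom_eq_bot_iff k).2 hGC)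
  let e := LinearEquiv.ofInjective _ hinj
  have hrank : Module.finrank ℤ (LinearMap.range (classHom k G)) = r := by
    rw [← hr, ← e.finrank_eq]
    rfl
  obtain ⟨b, D, β, hb, hβ⟩ := hsep.exists_basis _ hℓ hrank
  choose β' hβ' using fun i => classMod_surjective k (β i)
  obtain rfl : (fun i => classMod k (β' i)) = β := funext hβ'
  let b₁ : GroupBasis G r := b.map e.symm
  have hb₁ : ∀ i, classMod k (b₁.elem i) = ℓ ^ D i • classMod k (β' i) := by
    intro i
    rw [← classHom_basis, ← hb]
    exact congrArg Subtype.val (e.apply_symm_apply (b i))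
  have hD : ∀ i, IsDivParam k K ℓ (b₁.elem i) (D i) := by
    intro i
    rw [isDivParam_iff, hb₁]
    exact hβ.isGreatest hℓ.one_lt i (D i)
  refine ⟨b₁, ⟨D, hD, fun b' D' hD' => ?_⟩, D, fun i => b₁.elem i / β' i ^ ℓ ^ D i, β', hD,
    fun i => ?_, fun i => (div_mul_cancel _ _).symm, (isIndependent_iff k).2 hβ⟩
  · choose γ hγ using fun i => ((isDivParam_iff k).1 (hD' i)).1
    exact sum_le_sum_of_isIndepMod hℓ.one_lt b (b'.map e) hb hβ hγ
  · rw [← classMod_eq_iff, hb₁, classMod_pow]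

theorem ker_eq_bot_of_isGoodBasisMax (hfg : (⊤ : IntermediateField k K).FG) {ℓ : ℕ}
    (hℓ : ℓ.Prime) (hG : G.FG) {r : ℕ} (htf : Module.IsTorsionFree ℤ (Additive G))
    {b : GroupBasis G r} (hb : IsGoodBasisMax k ℓ b) :
    LinearMap.ker (classHom k G) = ⊥ := by
  have hsep := isIntSeparated k hfg
  have := hsep.isTorsionFree
  have := hG.finite_additive
  by_contra hker
  obtain ⟨D, hD, hmax⟩ := hb
  have hπ : classHom k G ≠ 0 := by
    intro h0
    apply hker
    -- If all of `G` is constant, no basis element has a divisibility parameter, so the basis is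
    -- empty.
    have hr : IsEmpty (Fin r) := by
      refine ⟨fun i => ?_⟩
      have h1 := ((isDivParam_iff k).1 (hD i)).2
      have h2 : classMod k (b.elem i) = 0 := by
        rw [← classHom_basis, h0]
        rfl
      have h3 := h1 (show D i + 1 ∈ _ from ⟨0, by rw [h2, smul_zero]⟩)
      omega
    have : Subsingleton (Additive G) := b.repr.toEquiv.subsingleton
    exact Subsingleton.elim _ _
  have hr : Module.finrank ℤ (Additive G) = r := by
    rw [Module.finrank_eq_card_basis b, Fintype.card_fin]
  -- One element of the new basis is divisible by `ℓ ^ (∑ D + 1)`, so its parameter alone exceeds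
  -- the supposed maximum.
  obtain ⟨b', i, hb', w, hw⟩ := exists_basis_map_eq_smul (classHom k G) hker hπ hr
    (pow_ne_zero (∑ i, D i + 1) hℓ.ne_zero)
  choose D' hD' using fun j => hsep.exists_isGreatest hℓ.one_lt (hb' j)
  have h1 := hmax b' D' fun j => (isDivParam_iff k).2 (hD' j)
  have h2 := (hD' i).2 ⟨w, hw⟩
  have h3 : D' i ≤ ∑ j, D' j := Finset.single_le_sum (fun _ _ => Nat.zero_le _) (Finset.mem_univ i)
  omega

theorem ker_eq_bot_of_isGoodBasisIndep (hfg : (⊤ : IntermediateField k K).FG) {ℓ : ℕ}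
    (hℓ : ℓ.Prime) {r : ℕ} {b : GroupBasis G r} (hb : IsGoodBasisIndep k ℓ b) :
    LinearMap.ker (classHom k G) = ⊥ := by
  have := (isIntSeparated k hfg).isTorsionFree
  obtain ⟨D, c, β, -, hc, hbc, hβ⟩ := hb
  have hli := ((isIndependent_iff k).1 hβ).linearIndependent hℓ.one_lt
  have hbβ : ∀ i, classHom k G (b i) = ((ℓ : ℤ) ^ D i) • classMod k (β i) := by
    intro i
    rw [classHom_basis, ← Nat.cast_pow, natCast_zsmul, ← classMod_pow, classMod_eq_iff, hbc]
    simpa using hc i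
  rw [LinearMap.ker_eq_bot']
  intro g hg
  rw [← b.sum_repr g, map_sum] at hg
  simp only [map_smul, hbβ, smul_smul] at hg
  have h0 := Fintype.linearIndependent_iff.1 hli _ hg
  rw [← b.sum_repr g]
  refine Finset.sum_eq_zero fun i _ => ?_
  have hne : (ℓ : ℤ) ^ D i ≠ 0 := pow_ne_zero _ (by exact_mod_cast hℓ.ne_zero)
  rw [(mul_eq_zero.1 (h0 i)).resolve_right hne, zero_smul]

/-- By additivity the ranks agree iff the kernel has rank `0`, and a rank-`0` subgroup of a
torsion-free group is trivial. -/
theorem groupRank_eq_iff_of_surjective {A B : Type*} [CommGroup A] [CommGroup B]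
    [Module.Finite ℤ (Additive A)] [Module.IsTorsionFree ℤ (Additive A)] (f : A →* B)
    (hf : Function.Surjective f) : groupRank A = groupRank B ↔ f.ker = ⊥ := by
  let g : Additive A →ₗ[ℤ] Additive B := (MonoidHom.toAdditive f).toIntLinearMap
  have hg : Function.Surjective g := hf
  have hrn := Submodule.finrank_quotient_add_finrank (LinearMap.ker g)
  rw [(g.quotKerEquivOfSurjective hg).finrank_eq] at hrn
  have hker : f.ker = ⊥ ↔ LinearMap.ker g = ⊥ := by
    rw [MonoidHom.ker_eq_bot_iff, LinearMap.ker_eq_bot]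
    rfl
  rw [groupRank, groupRank, hker, ← Submodule.finrank_eq_zero (R := ℤ)]
  omega

theorem groupRank_eq_groupRankModConst_iff (htf : Module.IsTorsionFree ℤ (Additive G))
    (hG : G.FG) :
    groupRank G = groupRankModConst k G ↔ LinearMap.ker (classHom k G) = ⊥ := by
  have := hG.finite_additive
  rw [groupRankModConst, groupRank_eq_iff_of_surjective _
    (QuotientGroup.mk'_surjective ((constUnits k K).subgroupOf G)), QuotientGroup.ker_mk',
    ker_classHom_eq_bot_iff, Subgroup.subgroupOf_eq_bot, disjoint_iff, inf_comm]

theorem exists_pow_le (hfg : (⊤ : IntermediateField k K).FG) {ℓ : ℕ} (hℓ : ℓ.Prime)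
    (hG : G.FG) (hGC : G ⊓ constUnits k K = ⊥) :
    ∃ ε : ℕ, ∀ n : ℕ, ε ≤ n →
      G ⊓ constMulPow k K (ℓ ^ n) ≤ G.map (powMonoidHom (ℓ ^ (n - ε))) := by
  have hsep := isIntSeparated k hfg
  have := hsep.isTorsionFree
  have := hG.finite_additive
  have hinj : Function.Injective (classHom k G) :=
    LinearMap.ker_eq_bot.1 ((ker_classHom_eq_bot_iff k).2 hGC)
  obtain ⟨ε, hε⟩ := hsep.exists_uniform_pow (LinearMap.range (classHom k G)) hℓ.ne_zero
  refine ⟨ε, fun n hn => ?_⟩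
  rintro g ⟨hg, hgn⟩
  obtain ⟨w, hw⟩ := (mem_constMulPow_iff k).1 hgn
  obtain ⟨h, hh⟩ := hε w ⟨n, Additive.ofMul ⟨g, hg⟩, hw⟩
  have heq : Additive.ofMul (⟨g, hg⟩ : G) = ℓ ^ (n - ε) • h := by
    apply hinj
    rw [map_nsmul, hh, ← mul_smul, ← pow_add, Nat.sub_add_cancel hn]
    exact hw
  exact ⟨(h.toMul : Kˣ), h.toMul.2,
    (congrArg (fun y : Additive G => (y.toMul : Kˣ)) heq).symm⟩

end Classes

end ModConst

/-! ### Kummer theory: degree as an index -/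

section Kummer

variable {F Ω : Type*} [Field F] [Field Ω] [Algebra F Ω]

/-- As `N` is invertible in `F`, `X ^ N - a` is separable, so outside `F` the element `y` would have
another conjugate, to which some automorphism moves it. -/
theorem mem_range_algebraMap_of_pow_of_fixed [IsAlgClosed Ω] [Algebra.IsAlgebraic F Ω]
    {N : ℕ} (hN : (N : F) ≠ 0) {y : Ω} (hy : y ≠ 0)
    {a : F} (hya : y ^ N = algebraMap F Ω a) (hfix : ∀ σ : Ω ≃ₐ[F] Ω, σ y = y) :
    y ∈ (algebraMap F Ω).range := by
  have : IsAlgClosure F Ω := ⟨inferInstance, inferInstance⟩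
  have : Normal F Ω := IsAlgClosure.normal F Ω
  have ha : a ≠ 0 := by
    rintro rfl
    rw [map_zero] at hya
    exact hy (pow_eq_zero_iff (M₀ := Ω) (fun h => hN (by simp [h])) |>.1 hya)
  have hsep : IsSeparable F y := by
    refine (Polynomial.separable_X_pow_sub_C a hN ha).of_dvd (minpoly.dvd F y ?_)
    simp [hya]
  by_contra hne
  have hbot : y ∉ (⊥ : Subalgebra F Ω) := by
    rwa [Algebra.mem_bot]
  obtain ⟨z, hz, hconj⟩ := (notMem_iff_exists_ne_and_isConjRoot hsep
    (IsAlgClosed.splits _)).1 hbot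
  obtain ⟨σ, hσ⟩ := isConjRoot_iff_exists_algEquiv.1 hconj
  apply hz
  have h1 : σ⁻¹ y = z := by
    rw [← hσ]
    exact σ.symm_apply_apply z
  rw [← hfix σ⁻¹, h1]

/-- The units coming from the base field. -/
noncomputable abbrev baseUnits (F Ω : Type*) [Field F] [Field Ω] [Algebra F Ω] : Subgroup Ωˣ :=
  (Units.map (algebraMap F Ω : F →* Ω)).range

theorem mem_baseUnits_iff {x : Ωˣ} : x ∈ baseUnits F Ω ↔ (x : Ω) ∈ (algebraMap F Ω).range := by
  constructor
  · rintro ⟨a, rfl⟩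
    exact ⟨a, rfl⟩
  · rintro ⟨a, ha⟩
    have ha0 : a ≠ 0 := by
      rintro rfl
      exact x.ne_zero (by rw [← ha, map_zero])
    exact ⟨Units.mk0 a ha0, Units.ext ha⟩

/-- The Kummer character attached to an `N`-th root of an element of a field containing the
`N`-th roots of unity. -/
noncomputable def kummerCharacter {N : ℕ} (hζ : ∀ ζ : Ω, ζ ^ N = 1 → ζ ∈ (algebraMap F Ω).range)
    (x : Ωˣ) (hx : x ^ N ∈ baseUnits F Ω) : (Ω ≃ₐ[F] Ω) →* Ω where
  toFun σ := σ x / x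
  map_one' := div_self x.ne_zero
  map_mul' σ τ := by
    obtain ⟨a, ha⟩ := mem_baseUnits_iff.1 hx
    have h1 : (τ (x : Ω) / x) ^ N = 1 := by
      rw [div_pow, ← map_pow, ← Units.val_pow_eq_pow_val, ← ha, AlgEquiv.commutes]
      exact div_self (by rw [ha]; exact (x ^ N).ne_zero)
    obtain ⟨c, hc⟩ := hζ _ h1
    have h2 : τ (x : Ω) = algebraMap F Ω c * x := by
      rw [hc, div_mul_cancel₀ _ x.ne_zero]
    rw [AlgEquiv.mul_apply, h2, map_mul, AlgEquiv.commutes, mul_div_assoc, mul_div_assoc,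
      div_self x.ne_zero, mul_one, mul_comm]

/-- Radicals in distinct classes modulo `Fˣ` have distinct Kummer characters, and distinct
characters are linearly independent (Dedekind). -/
theorem linearIndependent_of_pow_mem [IsAlgClosed Ω] [Algebra.IsAlgebraic F Ω]
    {N : ℕ} (hN : (N : F) ≠ 0)
    (hζ : ∀ ζ : Ω, ζ ^ N = 1 → ζ ∈ (algebraMap F Ω).range) {ι : Type*} (x : ι → Ωˣ)
    (hx : ∀ i, x i ^ N ∈ baseUnits F Ω) (hinj : ∀ i j, x i / x j ∈ baseUnits F Ω → i = j) :
    LinearIndependent F fun i => (x i : Ω) := by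
  let χ : ι → (Ω ≃ₐ[F] Ω) →* Ω := fun i => kummerCharacter hζ (x i) (hx i)
  have hχ : Function.Injective χ := by
    intro i j hij
    apply hinj
    rw [mem_baseUnits_iff]
    obtain ⟨a, ha⟩ := mem_baseUnits_iff.1
      ((div_pow (x i) (x j) N).symm ▸ (baseUnits F Ω).div_mem (hx i) (hx j))
    refine mem_range_algebraMap_of_pow_of_fixed hN (x i / x j).ne_zero (a := a) ?_ fun σ => ?_
    · rw [ha, Units.val_pow_eq_pow_val]
    · have h1 : σ (x i) / x i = σ (x j) / x j := DFunLike.congr_fun hij σ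
      have h2 : σ (x j : Ω) ≠ 0 := (map_ne_zero σ).2 (x j).ne_zero
      rw [Units.val_div_eq_div_val, map_div₀, div_eq_div_iff h2 (x j).ne_zero]
      rw [div_eq_div_iff (x i).ne_zero (x j).ne_zero] at h1
      rw [h1, mul_comm]
  have hli := (linearIndependent_monoidHom (Ω ≃ₐ[F] Ω) Ω).comp χ hχ
  rw [linearIndependent_iff'] at hli ⊢
  intro s c hc i hi
  -- Applying `σ` to `∑ c i • x i = 0` gives `∑ (c i * x i) * χ i σ = 0`.
  have h1 := hli s (fun i => algebraMap F Ω (c i) * x i) (by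
    funext σ
    have h2 := congrArg σ hc
    rw [map_zero, map_sum] at h2
    rw [Finset.sum_apply, Pi.zero_apply, ← h2]
    refine Finset.sum_congr rfl fun j _ => ?_
    have h3 : χ j σ = σ (x j) / x j := rfl
    simp only [Function.comp_apply, Pi.smul_apply, smul_eq_mul, h3, map_smul]
    rw [Algebra.smul_def, mul_assoc, mul_div_cancel₀ _ (x j).ne_zero]) i hi
  simpa using h1

/-- Representatives of `W` modulo `Fˣ` form an `F`-basis: they span because `W` is closed under
products. If the index is infinite, both sides are `0` by convention. -/
theorem finrank_adjoin_eq_relIndex [IsAlgClosed Ω] [Algebra.IsAlgebraic F Ω]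
    {N : ℕ} (hN : (N : F) ≠ 0)
    (hζ : ∀ ζ : Ω, ζ ^ N = 1 → ζ ∈ (algebraMap F Ω).range) {W : Subgroup Ωˣ}
    (hW : ∀ w ∈ W, w ^ N ∈ baseUnits F Ω) :
    Module.finrank F (IntermediateField.adjoin F ((fun u : Ωˣ => (u : Ω)) '' W)) =
      (baseUnits F Ω).relIndex W := by
  let Q := W ⧸ (baseUnits F Ω).subgroupOf W
  let x : Q → Ωˣ := fun q => (q.out : W)
  have hli : LinearIndependent F fun q => (x q : Ω) := by
    refine linearIndependent_of_pow_mem hN hζ x (fun q => hW _ q.out.2) fun q q' h => ?_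
    rw [← q.out_eq', ← q'.out_eq']
    refine QuotientGroup.eq_iff_div_mem.2 ?_
    rw [Subgroup.mem_subgroupOf]
    exact h
  have hspan : (IntermediateField.adjoin F ((fun u : Ωˣ => (u : Ω)) '' W)).toSubalgebra.toSubmodule
      = Submodule.span F (Set.range fun q => (x q : Ω)) := by
    rw [IntermediateField.adjoin_toSubalgebra_of_isAlgebraic
      (fun y _ => Algebra.IsAlgebraic.isAlgebraic y), Algebra.adjoin_eq_span]
    apply le_antisymm
    · have hcl : Submonoid.closure ((fun u : Ωˣ => (u : Ω)) '' W) ≤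
          W.toSubmonoid.map (Units.coeHom Ω) := Submonoid.closure_le.2 (by
            rintro _ ⟨w, hw, rfl⟩
            exact ⟨w, hw, rfl⟩)
      rw [Submodule.span_le]
      intro y hy
      obtain ⟨w, hw, rfl⟩ := hcl hy
      let q : Q := QuotientGroup.mk ⟨w, hw⟩
      have h1 : (⟨w, hw⟩ : W) / q.out ∈ (baseUnits F Ω).subgroupOf W :=
        QuotientGroup.eq_iff_div_mem.1 (QuotientGroup.out_eq' q).symm
      obtain ⟨a, ha⟩ := mem_baseUnits_iff.1 (Subgroup.mem_subgroupOf.1 h1)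
      have h2 : (w : Ω) = a • (x q : Ω) := by
        rw [Algebra.smul_def, ha, ← Units.val_mul]
        congr 1
        exact (div_mul_cancel w (x q)).symm
      change (w : Ω) ∈ _
      rw [h2]
      exact Submodule.smul_mem _ _ (Submodule.subset_span ⟨q, rfl⟩)
    · rw [Submodule.span_le]
      rintro _ ⟨q, rfl⟩
      exact Submodule.subset_span (Submonoid.subset_closure ⟨x q, q.out.2, rfl⟩)
  have h1 : Module.finrank F (IntermediateField.adjoin F ((fun u : Ωˣ => (u : Ω)) '' W)) =
      Module.finrank F (Submodule.span F (Set.range fun q => (x q : Ω))) := by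
    rw [← hspan]
    rfl
  rw [h1, Module.finrank_eq_nat_card_basis (Module.Basis.span hli)]
  rfl

end Kummer

/-! ### Growth of the index of `p ^ n`-th powers -/

section PowerIndex

theorem index_range_powMonoidHom {H : Type*} [CommGroup H] [Module.Finite ℤ (Additive H)]
    [Module.IsTorsionFree ℤ (Additive H)] {m : ℕ} (hm : m ≠ 0) :
    (powMonoidHom m : H →* H).range.index = m ^ ModConst.groupRank H := by
  have : NeZero m := ⟨hm⟩
  rw [ModConst.groupRank, ← ModN.natCard_eq (G := Additive H) (n := m),
    ← Subgroup.index_toAddSubgroup]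
  have h : Subgroup.toAddSubgroup (powMonoidHom m : H →* H).range =
      (LinearMap.range (LinearMap.lsmul ℤ (Additive H) m)).toAddSubgroup := by
    ext x
    constructor
    · rintro ⟨y, hy⟩
      exact ⟨Additive.ofMul y, (natCast_zsmul _ _).trans hy⟩
    · rintro ⟨y, hy⟩
      exact ⟨y.toMul, (natCast_zsmul _ _).symm.trans hy⟩
  rw [h]
  rfl

theorem powMonoidHom_injective {H : Type*} [CommGroup H]
    [Module.IsTorsionFree ℤ (Additive H)] {m : ℕ} (hm : m ≠ 0) :
    Function.Injective (powMonoidHom m : H →* H) := by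
  intro x y hxy
  have hm' : (m : ℤ) ≠ 0 := by exact_mod_cast hm
  refine smul_right_injective (Additive H) hm'
    (?_ : (m : ℤ) • Additive.ofMul x = (m : ℤ) • Additive.ofMul y)
  rw [natCast_zsmul, natCast_zsmul]
  exact hxy

/-- For `n ≥ ε`, `H ∩ A^(p^(n+1))` is the image of `H ∩ A^(p^n)` under the injective `p`-th power
map of `H`, so the index gains the factor `[H : H^p]`. -/
theorem relIndex_range_pow_succ {A : Type*} [CommGroup A] {H : Subgroup A}
    [Module.Finite ℤ (Additive H)] [Module.IsTorsionFree ℤ (Additive H)] {p : ℕ} (hp : p ≠ 0)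
    (hroots : ∀ ζ : A, ζ ^ p = 1 → ∀ n, ζ ∈ (powMonoidHom (p ^ n) : A →* A).range) {ε : ℕ}
    (hε : ∀ n, ε ≤ n → H ⊓ (powMonoidHom (p ^ n) : A →* A).range ≤
      H.map (powMonoidHom (p ^ (n - ε)))) {n : ℕ} (hn : ε ≤ n) :
    (powMonoidHom (p ^ n) : A →* A).range.relIndex H ≠ 0 ∧
    (powMonoidHom (p ^ (n + 1)) : A →* A).range.relIndex H =
      (powMonoidHom (p ^ n) : A →* A).range.relIndex H * p ^ ModConst.groupRank H := by
  constructor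
  · intro h0
    have hle : (powMonoidHom (p ^ n) : H →* H).range ≤
        (powMonoidHom (p ^ n) : A →* A).range.subgroupOf H := by
      rintro _ ⟨x, rfl⟩
      exact ⟨x, rfl⟩
    have h1 := Subgroup.index_dvd_of_le hle
    have h2 : ((powMonoidHom (p ^ n) : A →* A).range.subgroupOf H).index = 0 := h0
    rw [h2, zero_dvd_iff, index_range_powMonoidHom (pow_ne_zero _ hp)] at h1
    exact pow_ne_zero _ (pow_ne_zero _ hp) h1
  · have hmap : (powMonoidHom (p ^ (n + 1)) : A →* A).range.subgroupOf H =
        ((powMonoidHom (p ^ n) : A →* A).range.subgroupOf H).map (powMonoidHom p) := by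
      ext g
      rw [Subgroup.mem_subgroupOf]
      constructor
      · intro hg
        obtain ⟨h, hh, hhg⟩ := hε (n + 1) (by omega) ⟨g.2, hg⟩
        obtain ⟨m, hm⟩ := hg
        simp only [powMonoidHom_apply] at hhg hm
        let y : H := ⟨h, hh⟩ ^ p ^ (n - ε)
        have hy : (y : A) = h ^ p ^ (n - ε) := rfl
        have hyp : (y : A) ^ p = g := by
          rw [hy, ← hhg, ← pow_mul, ← pow_succ]
          congr 2
          omega
        -- The `p`-th root `y` of `g` in `H` differs from `m ^ p ^ n` by a `p`-th root of unity,
        -- itself a `p ^ n`-th power, so `y` is one too.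
        have h1 : ((y : A) / m ^ p ^ n) ^ p = 1 := by
          rw [div_pow, hyp, ← hm, ← pow_mul, ← pow_succ, div_self']
        have h2 : (y : A) ∈ (powMonoidHom (p ^ n) : A →* A).range := by
          rw [← div_mul_cancel (y : A) (m ^ p ^ n)]
          exact Subgroup.mul_mem _ (hroots _ h1 n) ⟨m, rfl⟩
        exact ⟨y, h2, Subtype.ext hyp⟩
      · rintro ⟨y, ⟨m, hm⟩, rfl⟩
        refine ⟨m, ?_⟩
        simp only [powMonoidHom_apply, H.subtype_apply, Subgroup.coe_pow] at hm ⊢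
        rw [← hm, pow_succ, pow_mul]
    rw [Subgroup.relIndex, Subgroup.relIndex, hmap,
      Subgroup.index_map_of_injective _ (powMonoidHom_injective hp), index_range_powMonoidHom hp]

end PowerIndex

/-! ### The field `k̄K` and the degree of its Kummer extensions -/

namespace ModConst

section Geometric

variable {k K Ω : Type*} [Field k] [Field K] [Field Ω] [Algebra k Ω] [Algebra K Ω]

variable (k K Ω) in
/-- The field `k̄K` inside an extension `Ω` of `K`, as an extension of the algebraic closure of `k`
in `Ω`. -/
noncomputable def geomField : IntermediateField (algebraicClosure k Ω) Ω :=
  IntermediateField.adjoin (algebraicClosure k Ω) (Set.range (algebraMap K Ω))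

variable (k K Ω) in
/-- The embedding of `K` in `k̄K`. -/
noncomputable def toGeomField : K →+* geomField k K Ω :=
  (algebraMap K Ω).codRestrict (geomField k K Ω)
    fun x => IntermediateField.subset_adjoin _ _ ⟨x, rfl⟩

theorem geomField_fg [Algebra k K] [IsScalarTower k K Ω]
    (hfg : (⊤ : IntermediateField k K).FG) :
    (⊤ : IntermediateField (algebraicClosure k Ω) (geomField k K Ω)).FG := by
  rw [IntermediateField.fg_top_iff, IntermediateField.essFiniteType_iff]
  obtain ⟨S, hS⟩ := hfg
  rw [IntermediateField.fg_def]
  refine ⟨algebraMap K Ω '' S, S.finite_toSet.image _, le_antisymm ?_ ?_⟩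
  · exact IntermediateField.adjoin.mono _ _ _ (Set.image_subset_range _ _)
  · rw [geomField, IntermediateField.adjoin_le_iff]
    rintro _ ⟨x, rfl⟩
    have hx : x ∈ IntermediateField.adjoin k (S : Set K) := hS ▸ IntermediateField.mem_top
    have hle : IntermediateField.adjoin k (S : Set K) ≤
        ((IntermediateField.adjoin (algebraicClosure k Ω)
          (algebraMap K Ω '' S)).restrictScalars k).comap (IsScalarTower.toAlgHom k K Ω) := by
      rw [IntermediateField.adjoin_le_iff]
      intro y hy
      exact IntermediateField.subset_adjoin _ _ ⟨y, hy, rfl⟩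
    exact hle hx

theorem mem_geomField_of_isAlgebraic {x : Ω} (hx : IsAlgebraic k x) : x ∈ geomField k K Ω :=
  (geomField k K Ω).algebraMap_mem ⟨x, mem_algebraicClosure_iff.2 hx⟩

theorem isAlgebraic_of_isAlgebraic_algebraicClosure {x : Ω}
    (hx : IsAlgebraic (algebraicClosure k Ω) x) : IsAlgebraic k x :=
  hx.restrictScalars k

/-- The constants of `k̄K` lie in the algebraically closed `k̄`, so they are already `m`-th powers
there. -/
theorem constMulPow_geomField [IsAlgClosed Ω] {m : ℕ} (hm : m ≠ 0) :
    constMulPow (algebraicClosure k Ω) (geomField k K Ω) m =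
      (powMonoidHom m : (geomField k K Ω)ˣ →* (geomField k K Ω)ˣ).range := by
  refine sup_eq_right.2 fun c hc => ?_
  have hc' : IsAlgebraic k ((c : geomField k K Ω) : Ω) :=
    isAlgebraic_of_isAlgebraic_algebraicClosure
      (((mem_constUnits_iff _).1 hc).algHom (geomField k K Ω).val)
  obtain ⟨y, hy⟩ := IsAlgClosed.exists_pow_nat_eq ((c : geomField k K Ω) : Ω) (Nat.pos_of_ne_zero hm)
  have hyalg : IsAlgebraic k y := (isAlgebraic_iff_isIntegral.2
    (IsIntegral.of_pow (Nat.pos_of_ne_zero hm) (hy ▸ hc'.isIntegral)))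
  have hy0 : (⟨y, mem_geomField_of_isAlgebraic hyalg⟩ : geomField k K Ω) ≠ 0 := by
    intro h
    have hy0 : y = 0 := congrArg Subtype.val h
    rw [hy0, zero_pow hm] at hy
    exact c.ne_zero (Subtype.ext hy.symm)
  exact ⟨Units.mk0 _ hy0, Units.ext (Subtype.ext hy)⟩

variable (k Ω) in
/-- The image in `k̄K` of a group of units of `K`. -/
noncomputable def geomGroup (G : Subgroup Kˣ) : Subgroup (geomField k K Ω)ˣ :=
  G.map (Units.map (toGeomField k K Ω : K →* geomField k K Ω))

theorem geomGroup_inf_constUnits [Algebra k K] [IsScalarTower k K Ω] {G : Subgroup Kˣ} (hGC : G ⊓ constUnits k K = ⊥) :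
    geomGroup k Ω G ⊓ constUnits (algebraicClosure k Ω) (geomField k K Ω) = ⊥ := by
  rw [Subgroup.eq_bot_iff_forall] at hGC ⊢
  rintro _ ⟨⟨g, hg, rfl⟩, hc⟩
  have h1 : IsAlgebraic k (algebraMap K Ω (g : K)) :=
    isAlgebraic_of_isAlgebraic_algebraicClosure
      (((mem_constUnits_iff _).1 hc).algHom (geomField k K Ω).val)
  have h2 : IsAlgebraic k (g : K) :=
    (isAlgebraic_algHom_iff (IsScalarTower.toAlgHom k K Ω) (algebraMap K Ω).injective).1 h1
  rw [hGC g ⟨hg, (mem_constUnits_iff k).2 h2⟩, map_one]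

theorem map_geomGroup (G : Subgroup Kˣ) :
    (geomGroup k Ω G).map (Units.map (algebraMap (geomField k K Ω) Ω : _ →* Ω)) =
      G.map (Units.map (algebraMap K Ω : K →* Ω)) := by
  rw [geomGroup, Subgroup.map_map]
  rfl

theorem geomKummer_toSubfield [Algebra k K] (G : Subgroup Kˣ) {m : ℕ} (hm : m ≠ 0) :
    (geomKummer k Ω G m).toSubfield = (IntermediateField.adjoin (geomField k K Ω)
      ((fun u : Ωˣ => (u : Ω)) '' ((G.map (Units.map (algebraMap K Ω : K →* Ω))).comap
        (powMonoidHom m)))).toSubfield := by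
  apply le_antisymm
  · refine Subfield.closure_le.2 ?_
    rintro x (⟨y, rfl⟩ | hx | ⟨g, hg, hx⟩)
    · exact IntermediateField.algebraMap_mem _ (toGeomField k K Ω y)
    · exact IntermediateField.algebraMap_mem _
        (⟨x, (geomField k K Ω).algebraMap_mem ⟨x, hx⟩⟩ : geomField k K Ω)
    · have hx0 : x ≠ 0 := by
        rintro rfl
        rw [zero_pow hm] at hx
        exact g.ne_zero ((map_eq_zero _).1 hx.symm)
      exact IntermediateField.subset_adjoin _ _
        ⟨Units.mk0 x hx0, ⟨g, hg, Units.ext hx.symm⟩, rfl⟩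
  · refine Subfield.closure_le.2 ?_
    rintro x (⟨y, rfl⟩ | ⟨u, ⟨g, hg, hu⟩, rfl⟩)
    · have hle : (geomField k K Ω).toSubfield ≤ (geomKummer k Ω G m).toSubfield := by
        refine Subfield.closure_le.2 ?_
        rintro z (⟨c, rfl⟩ | ⟨a, rfl⟩)
        · exact IntermediateField.subset_adjoin _ _ (Or.inl c.2)
        · exact IntermediateField.algebraMap_mem _ a
      exact hle y.2
    · exact IntermediateField.subset_adjoin _ _ (Or.inr ⟨g, hg, (congrArg Units.val hu).symm⟩)

theorem isAlgebraic_geomField [Algebra.IsAlgebraic K Ω] :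
    Algebra.IsAlgebraic (geomField k K Ω) Ω := by
  refine ⟨fun x => ?_⟩
  obtain ⟨p, hp, hpx⟩ := Algebra.IsAlgebraic.isAlgebraic (R := K) x
  refine ⟨p.map (toGeomField k K Ω),
    (Polynomial.map_ne_zero_iff (toGeomField k K Ω).injective).2 hp, ?_⟩
  rw [Polynomial.aeval_def] at hpx ⊢
  rw [Polynomial.eval₂_map]
  exact hpx

theorem finrank_adjoin_geomField [IsAlgClosed Ω] [Algebra.IsAlgebraic K Ω] (G : Subgroup Kˣ)
    {m : ℕ} (hm : (m : k) ≠ 0) :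
    Module.finrank (geomField k K Ω) (IntermediateField.adjoin (geomField k K Ω)
      ((fun u : Ωˣ => (u : Ω)) '' ((G.map (Units.map (algebraMap K Ω : K →* Ω))).comap
        (powMonoidHom m)))) =
      (powMonoidHom m : (geomField k K Ω)ˣ →* (geomField k K Ω)ˣ).range.relIndex
        (geomGroup k Ω G) := by
  have := isAlgebraic_geomField (k := k) (K := K) (Ω := Ω)
  have hm0 : m ≠ 0 := by
    rintro rfl
    simp at hm
  have hmF : (m : geomField k K Ω) ≠ 0 := by
    have h := (map_ne_zero (algebraMap k (geomField k K Ω))).2 hm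
    rwa [map_natCast] at h
  have hroots : ∀ ζ : Ω, ζ ^ m = 1 → ζ ∈ (algebraMap (geomField k K Ω) Ω).range := by
    intro ζ hζ
    have h1 : IsIntegral k ζ :=
      IsIntegral.of_pow (Nat.pos_of_ne_zero hm0) (hζ ▸ isIntegral_one)
    exact ⟨⟨ζ, mem_geomField_of_isAlgebraic h1.isAlgebraic⟩, rfl⟩
  set ι : (geomField k K Ω)ˣ →* Ωˣ := Units.map (algebraMap (geomField k K Ω) Ω : _ →* Ω) with hι
  have hιinj : Function.Injective ι := Units.map_injective Subtype.val_injective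
  have hG : G.map (Units.map (algebraMap K Ω : K →* Ω)) = (geomGroup k Ω G).map ι :=
    (map_geomGroup G).symm
  have hsurj : Function.Surjective (powMonoidHom m : Ωˣ →* Ωˣ) := by
    intro u
    obtain ⟨y, hy⟩ := IsAlgClosed.exists_pow_nat_eq (u : Ω) (Nat.pos_of_ne_zero hm0)
    have hy0 : y ≠ 0 := by
      rintro rfl
      rw [zero_pow hm0] at hy
      exact u.ne_zero hy.symm
    exact ⟨Units.mk0 y hy0, Units.ext hy⟩
  rw [finrank_adjoin_eq_relIndex hmF hroots (by
    intro w hw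
    rw [hG] at hw
    obtain ⟨g, -, hg⟩ := hw
    exact ⟨g, hg⟩), hG]
  -- An element whose `m`-th power is an `m`-th power from `k̄K` lies in `k̄K`, which contains the
  -- `m`-th roots of unity; the index then transfers along `x ↦ x ^ m`.
  have hpow : (baseUnits (geomField k K Ω) Ω) =
      ((powMonoidHom m : (geomField k K Ω)ˣ →* (geomField k K Ω)ˣ).range.map ι).comap
        (powMonoidHom m) := by
    ext x
    constructor
    · rintro ⟨y, rfl⟩
      exact ⟨y ^ m, ⟨y, rfl⟩, map_pow _ _ _⟩
    · rintro ⟨_, ⟨y, rfl⟩, hy⟩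
      have h1 : (x / ι y) ^ m = 1 := by
        rw [div_pow, div_eq_one, ← map_pow]
        exact hy.symm
      have h2 : x / ι y ∈ baseUnits (geomField k K Ω) Ω :=
        mem_baseUnits_iff.2 (hroots _ (by simpa using congrArg Units.val h1))
      rw [← div_mul_cancel x (ι y)]
      exact Subgroup.mul_mem _ h2 ⟨y, rfl⟩
  rw [hpow, Subgroup.relIndex_comap, Subgroup.map_comap_eq_self_of_surjective hsurj,
    Subgroup.relIndex_map_map_of_injective _ _ hιinj]

theorem relfinrank_geomKummer [Algebra k K] [IsScalarTower k K Ω] [IsAlgClosed Ω]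
    [Algebra.IsAlgebraic K Ω] (hfg : (⊤ : IntermediateField k K).FG)
    {ℓ : ℕ} (hℓ : ℓ.Prime) (hchar : (ℓ : k) ≠ 0) {G : Subgroup Kˣ} (hG : G.FG)
    (hGC : G ⊓ constUnits k K = ⊥) :
    ∀ᶠ n : ℕ in atTop, IntermediateField.relfinrank (geomKummer k Ω G (ℓ ^ n))
      (geomKummer k Ω G (ℓ ^ (n + 1))) = ℓ ^ groupRank G := by
  have hfg' := geomField_fg (Ω := Ω) hfg
  have hGC' := geomGroup_inf_constUnits (Ω := Ω) hGC
  have hG' : (geomGroup k Ω G).FG := by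
    classical
    obtain ⟨S, hS⟩ := hG
    refine ⟨S.image (Units.map (toGeomField k K Ω : K →* geomField k K Ω)), ?_⟩
    rw [Finset.coe_image, ← MonoidHom.map_closure, hS, geomGroup]
  have hker := (ker_classHom_eq_bot_iff _).2 hGC'
  have := hG'.finite_additive
  have hsep := isIntSeparated _ hfg'
  have := hsep.isTorsionFree
  have htf : Module.IsTorsionFree ℤ (Additive (geomGroup k Ω G)) :=
    (LinearMap.ker_eq_bot.1 hker).moduleIsTorsionFree _ (map_smul _)
  obtain ⟨ε, hε⟩ := exists_pow_le _ hfg' hℓ hG' hGC'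
  have hrank : groupRank (geomGroup k Ω G) = groupRank G := by
    have hinj : Function.Injective (Units.map (toGeomField k K Ω : K →* geomField k K Ω)) :=
      Units.map_injective (toGeomField k K Ω).injective
    exact (LinearEquiv.finrank_eq
      (MulEquiv.toAdditive (G.equivMapOfInjective _ hinj)).toIntLinearEquiv).symm
  have hcast : ∀ n, ((ℓ ^ n : ℕ) : k) ≠ 0 := fun n => by
    rw [Nat.cast_pow]
    exact pow_ne_zero n hchar
  have hne : ∀ n, ℓ ^ n ≠ 0 := fun n => pow_ne_zero n hℓ.ne_zero
  let W : ℕ → Subgroup Ωˣ := fun n =>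
    (G.map (Units.map (algebraMap K Ω : K →* Ω))).comap (powMonoidHom (ℓ ^ n))
  let E : ℕ → IntermediateField (geomField k K Ω) Ω := fun n =>
    IntermediateField.adjoin _ ((fun u : Ωˣ => (u : Ω)) '' (W n))
  filter_upwards [eventually_ge_atTop ε] with n hn
  have hEle : E n ≤ E (n + 1) := by
    refine IntermediateField.adjoin.mono _ _ _ (Set.image_mono fun u hu => ?_)
    have h1 := Subgroup.pow_mem (G.map (Units.map (algebraMap K Ω : K →* Ω))) hu ℓ
    change u ^ ℓ ^ (n + 1) ∈ G.map (Units.map (algebraMap K Ω : K →* Ω))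
    rw [pow_succ, pow_mul]
    exact h1
  -- The relative degree is the quotient of two indices over `k̄K`; the lower one is nonzero, so it
  -- cancels.
  have hmul := IntermediateField.relfinrank_mul_relfinrank (bot_le (a := E n)) hEle
  rw [IntermediateField.relfinrank_bot_left, IntermediateField.relfinrank_bot_left,
    finrank_adjoin_geomField G (hcast n), finrank_adjoin_geomField G (hcast (n + 1))] at hmul
  obtain ⟨h0, h1⟩ := relIndex_range_pow_succ (H := geomGroup k Ω G) hℓ.ne_zero (fun ζ hζ n => by
    rw [← constMulPow_geomField (hne n)]
    refine Subgroup.mem_sup_left ((mem_constUnits_iff _).2 ?_)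
    refine (IsIntegral.of_pow hℓ.pos ?_).isAlgebraic
    rw [← Units.val_pow_eq_pow_val, hζ]
    exact isIntegral_one) (fun n hn => by
      rw [← constMulPow_geomField (hne n)]
      exact hε n hn) hn
  rw [h1, hrank] at hmul
  have hE : IntermediateField.relfinrank (geomKummer k Ω G (ℓ ^ n))
      (geomKummer k Ω G (ℓ ^ (n + 1))) = IntermediateField.relfinrank (E n) (E (n + 1)) := by
    rw [IntermediateField.relfinrank, geomKummer_toSubfield G (hne n),
      geomKummer_toSubfield G (hne (n + 1))]
    rfl
  rw [hE]
  exact Nat.eq_of_mul_eq_mul_left (Nat.pos_of_ne_zero h0) hmul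

end Geometric

end ModConst
-- The theorem
theorem mainTheorem4 {k K Ω : Type*} [Field k] [Field K] [Algebra k K]
    (hK : IsAlgFunctionField k K)
    [Field Ω] [Algebra k Ω] [Algebra K Ω] [IsScalarTower k K Ω] [IsAlgClosure K Ω]
    (ℓ : ℕ) (hℓ : ℓ.Prime) (hchar : ringChar k ≠ ℓ)
    (G : Subgroup Kˣ) (hG : G.FG) (r : ℕ) (hr : ModConst.groupRank G = r) :
    (0 < r → G ⊓ ModConst.constUnits k K = ⊥ →
      (∃ b : ModConst.GroupBasis G r,
        ModConst.IsGoodBasisMax k ℓ b ∧ ModConst.IsGoodBasisIndep k ℓ b) ∧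
      (∀ᶠ n : ℕ in atTop,
        IntermediateField.relfinrank (ModConst.geomKummer k Ω G (ℓ ^ n))
          (ModConst.geomKummer k Ω G (ℓ ^ (n + 1))) = ℓ ^ r) ∧
      (∃ ε : ℕ, ∀ n : ℕ, ε < n →
        G ⊓ ModConst.constMulPow k K (ℓ ^ n) ≤ G.map (powMonoidHom (ℓ ^ (n - ε))))) ∧
    ((∀ g ∈ G, IsOfFinOrder g → g = 1) →
      ((∃ b : ModConst.GroupBasis G r, ModConst.IsGoodBasisMax k ℓ b) ↔
        r = ModConst.groupRankModConst k G) ∧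
      ((∃ b : ModConst.GroupBasis G r, ModConst.IsGoodBasisIndep k ℓ b) ↔
        r = ModConst.groupRankModConst k G)) := by
  have hfg := hK.fg
  have : IsAlgClosed Ω := IsAlgClosure.isAlgClosed K
  have : Algebra.IsAlgebraic K Ω := IsAlgClosure.isAlgebraic
  have hℓk : (ℓ : k) ≠ 0 := by
    intro h0
    have hdvd : ringChar k ∣ ℓ := (ringChar.spec k ℓ).1 h0
    rcases (Nat.dvd_prime hℓ).1 hdvd with h1 | h1
    · exact CharP.ringChar_ne_one h1
    · exact hchar h1
  refine ⟨fun _ hGC => ⟨ModConst.exists_goodBasis k hfg hℓ hG hr hGC,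
    hr ▸ ModConst.relfinrank_geomKummer hfg hℓ hℓk hG hGC, ?_⟩, fun htors => ?_⟩
  · obtain ⟨ε, hε⟩ := ModConst.exists_pow_le k hfg hℓ hG hGC
    exact ⟨ε, fun n hn => hε n hn.le⟩
  · have htf : Module.IsTorsionFree ℤ (Additive G) := by
      refine Module.IsTorsionFree.of_smul_eq_zero fun n g h => ?_
      refine or_iff_not_imp_left.2 fun hn => ?_
      have h1 : (g.toMul : Kˣ) ^ n = 1 := congrArg (fun y : Additive G => (y.toMul : Kˣ)) h
      exact Subtype.ext (htors _ g.toMul.2 (isOfFinOrder_iff_zpow_eq_one.2 ⟨n, hn, h1⟩))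
    rw [← hr, ModConst.groupRank_eq_groupRankModConst_iff k htf hG, hr]
    have hex := fun h => ModConst.exists_goodBasis k hfg hℓ hG hr
      ((ModConst.ker_classHom_eq_bot_iff k).1 h)
    exact ⟨⟨fun ⟨b, hb⟩ => ModConst.ker_eq_bot_of_isGoodBasisMax k hfg hℓ hG htf hb,
        fun h => (hex h).imp fun _ hb => hb.1⟩,
      ⟨fun ⟨b, hb⟩ => ModConst.ker_eq_bot_of_isGoodBasisIndep k hfg hℓ hb,
        fun h => (hex h).imp fun _ hb => hb.2⟩⟩
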